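/- Let $n_r,n_t\ge 1$ and let $\mathsf H\in\mathbb R^{n_r\times n_t}$ be a fixed matrix of full rank $\min(n_r,n_t)$. For a convex compact set $\mathcal X\subset\mathbb R^{n_t}$ containing the origin let $$C(\mathcal X,\mathsf H)=\sup_{F_{\mathbf X}:\,\mathbf X\in\mathcal X\text{ a.s.}} I(\mathbf X;\mathsf H\mathbf X+\mathbf Z)$$ be the capacity, in bits, of the channel $\mathbf Y=\mathsf H\mathbf X+\mathbf Z$ with input space $\mathcal X$. The supremum is over all probability distributions of $\mathbf X$ on $\mathcal X$, and $\mathbf Z\sim\mathcal N(\mathbf 0,\mathsf I_{n_r})$ is independent of $\mathbf X$. Let $$r_{\min}(\mathcal X)=\max\{r\ge 0:\{\mathbf y:\|\mathbf y\|\le r\}\subseteq\mathcal X\},\qquad r_{\max}(\mathcal X)=\min\{r\ge 0:\mathcal X\subseteq\{\mathbf y:\|\mathbf y\|\le r\}\}$$ with the Euclidean norm. Then for every constant $c\in\mathbb R$, $$\lim_{r_{\min}(\mathcal X)\to\infty}\frac{C(\mathcal X,\mathsf H)}{\log_2\!\left(1+\frac{2r_{\min}(\mathcal X)}{\sqrt{2\pi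 e}}\right)}=\min(n_r,n_t),$$ where the limit is taken over all convex compact sets $\mathcal X\subset\mathbb R^{n_t}$ that contain the origin and satisfy $r_{\max}(\mathcal X)\le c\,r_{\min}(\mathcal X)$. That is, for every $\varepsilon>0$ there is an $R$, depending only on $\varepsilon$, $c$ and $\mathsf H$, such that the quotient is within $\varepsilon$ of $\min(n_r,n_t)$ for every such $\mathcal X$ with $r_{\min}(\mathcal X)\ge R$. -/

import Mathlib

open MeasureTheory ProbabilityTheory Filter Topology
open scoped ENNReal

noncomputable section

namespace MIMO

/-- The maximum radius `min {r ≥ 0 : S ⊆ B₀(r)}` of a subset of `ℝⁿ`. -/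
def rMax {n : ℕ} (S : Set (EuclideanSpace ℝ (Fin n))) : ℝ :=
  sInf {r : ℝ | 0 ≤ r ∧ S ⊆ Metric.closedBall 0 r}

/-- The minimum radius `max {r ≥ 0 : B₀(r) ⊆ S}` of a subset of `ℝⁿ`. -/
def rMin {n : ℕ} (S : Set (EuclideanSpace ℝ (Fin n))) : ℝ :=
  sSup {r : ℝ | 0 ≤ r ∧ Metric.closedBall 0 r ⊆ S}

/-- The mutual information, in bits, of a pair of random variables with joint law `J`:
the relative entropy (divided by `log 2`, as `klDiv` is in nats) of the joint law with respect to
the product of its marginals. -/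
def mutualInfo {α β : Type*} [MeasurableSpace α] [MeasurableSpace β] (J : Measure (α × β)) :
    ℝ≥0∞ :=
  InformationTheory.klDiv J (J.fst.prod J.snd) / ENNReal.ofReal (Real.log 2)

/-- The joint law of `(X, H X + Z)`, where `X` has law `P` and `Z` is a standard Gaussian vector
of `ℝ^{n_r}` independent of `X`. -/
def jointLaw {nr nt : ℕ} (H : Matrix (Fin nr) (Fin nt) ℝ)
    (P : Measure (EuclideanSpace ℝ (Fin nt))) :
    Measure (EuclideanSpace ℝ (Fin nt) × EuclideanSpace ℝ (Fin nr)) :=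
  (P.prod (stdGaussian (EuclideanSpace ℝ (Fin nr)))).map
    fun p => (p.1, Matrix.toEuclideanLin H p.1 + p.2)

/-- The capacity, in bits per channel use, of the channel `Y = H X + Z` with input space `S`:
the supremum of `I(X; H X + Z)` over all laws `P` of `X` with `X ∈ S` almost surely. -/
def capacity {nr nt : ℕ} (S : Set (EuclideanSpace ℝ (Fin nt)))
    (H : Matrix (Fin nr) (Fin nt) ℝ) : ℝ≥0∞ :=
  ⨆ (P : Measure (EuclideanSpace ℝ (Fin nt))) (_ : IsProbabilityMeasure P)
    (_ : ∀ᵐ x ∂P, x ∈ S), mutualInfo (jointLaw H P)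

/-- The channel input spaces (convex compact sets that contain the origin) whose maximum radius
is at most `c` times their minimum radius. -/
def inputSpaces (n : ℕ) (c : ℝ) : Set (Set (EuclideanSpace ℝ (Fin n))) :=
  {S | Convex ℝ S ∧ IsCompact S ∧ 0 ∈ S ∧ rMax S ≤ c * rMin S}

end MIMO

end

/-!
The quotient is squeezed between two bounds of the form `(k log r + O(1)) / log (1 + β r)`, where
`r` is the minimum radius, `k` the rank of `H`, and the constants depend only on `H` and `c`. Both
bounds use a rank factorization `H = A ∘ B` through `ℝᵏ` (`exists_rank_factorization`) and the
uniform distribution on a cube of `ℝᵏ` whose side is proportional to `r`; no differential entropies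
are needed.

Upper bound (`exists_capacity_le`). By the chain rule, replacing the output law by any other law `Q`
can only increase the relative entropy `D(P_{XY} ‖ P_X ⊗ P_Y)` (`klDiv_prod_snd_le`). If moreover
every conditional output law is at most `M • Q`, the relative entropy is at most `log M`. Take for
`Q` the law of `A U + W`, with `U` uniform on a cube of side `2 a` and `W` Gaussian of variance `2`.
Translates of the standard Gaussian by a bounded amount are dominated by a multiple of the law of
`W` (`exists_forall_map_add_stdGaussian_le`), and `U` lies in a given cube of side `2` with
probability `a⁻ᵏ`, so `M = O(aᵏ)` works.

Lower bound (`exists_le_capacity`). Let `L` be a left inverse of `A` and `V` a right inverse of `B`,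
so that `L H V` is the identity of `ℝᵏ`, and let `X = V U`. The Donsker–Varadhan inequality
(`le_klDiv_of_integral_exp_le`) is applied to `f (x, y) = -(k + 1) log (1 + ‖L y - L H x‖)`. Under
the joint law `L Y - L H X` is the image of the noise under `L`, so the integral of `f` is bounded below
by a constant. Under the product law, averaging `exp f` over the cube gives at most
`(2 a)⁻ᵏ ∫ (1 + ‖u‖)^(-(k + 1)) du`. Hence the mutual information is at least `k log a - O(1)`.

The hypothesis `rMax S ≤ c * rMin S` makes the cubes in both bounds comparable to `r`.
-/

namespace MIMO

/-! ### Bounds on the relative entropy and the mutual information -/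

section Information

open InformationTheory

variable {α β : Type*} [MeasurableSpace α] [MeasurableSpace β]

lemma rnDeriv_le_of_le_smul {μ ν : Measure α} [SigmaFinite ν] {M : ℝ≥0∞} (h : μ ≤ M • ν) :
    ∀ᵐ x ∂ν, μ.rnDeriv ν x ≤ M := by
  refine ae_le_of_forall_setLIntegral_le_of_sigmaFinite (Measure.measurable_rnDeriv μ ν)
    fun s _ _ => ?_
  calc ∫⁻ x in s, μ.rnDeriv ν x ∂ν ≤ μ s := Measure.setLIntegral_rnDeriv_le s
    _ ≤ M * ν s := h s
    _ = ∫⁻ _ in s, M ∂ν := by simp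

/-- A density bounded by `M` bounds the relative entropy by `log M`. -/
lemma klDiv_le_log_of_le_smul {μ ν : Measure α} [IsProbabilityMeasure μ] [IsProbabilityMeasure ν]
    {M : ℝ≥0∞} (hM : M ≠ ∞) (h : μ ≤ M • ν) :
    klDiv μ ν ≤ ENNReal.ofReal (Real.log M.toReal) := by
  have hac : μ ≪ ν := by
    refine Measure.AbsolutelyContinuous.mk fun s _ hs => ?_
    have := h s
    simpa [hs] using this
  have hle := rnDeriv_le_of_le_smul h
  have hint : Integrable (llr μ ν) μ := by
    rw [← integrable_rnDeriv_mul_log_iff hac]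
    -- The continuous function `t ↦ t * log t` is bounded on the range `[0, M]` of the density.
    obtain ⟨C, hC⟩ := (isCompact_Icc (a := (0 : ℝ)) (b := M.toReal)).exists_bound_of_continuousOn
      Real.continuous_mul_log.continuousOn
    refine Integrable.of_bound ?_ C ?_
    · exact (Real.continuous_mul_log.measurable.comp
        (Measure.measurable_rnDeriv μ ν).ennreal_toReal).aestronglyMeasurable
    · filter_upwards [hle] with x hx
      exact hC _ ⟨ENNReal.toReal_nonneg, ENNReal.toReal_mono hM hx⟩
  rw [klDiv_of_ac_of_integrable hac hint]
  refine ENNReal.ofReal_le_ofReal ?_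
  simp only [probReal_univ, add_sub_cancel_right]
  calc ∫ x, llr μ ν x ∂μ ≤ ∫ _, Real.log M.toReal ∂μ := by
        refine integral_mono_ae hint (integrable_const _) ?_
        filter_upwards [hac.ae_le hle, Measure.rnDeriv_pos hac] with x hx hx0
        exact Real.log_le_log (ENNReal.toReal_pos hx0.ne' (hx.trans_lt hM.lt_top).ne)
          (ENNReal.toReal_mono hM hx)
    _ = Real.log M.toReal := by simp

/-- Among all product measures with the same first factor, the one built from the second marginal
is the closest to `J` in relative entropy. This is half of the chain rule
`D(J ‖ P ⊗ Q) = D(J ‖ P ⊗ J.snd) + D(J.snd ‖ Q)`. -/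
lemma klDiv_prod_snd_le [StandardBorelSpace α] [Nonempty α] (J : Measure (α × β))
    [IsProbabilityMeasure J] (P : Measure α) [IsProbabilityMeasure P]
    (Q : Measure β) [IsProbabilityMeasure Q] :
    klDiv J (P.prod J.snd) ≤ klDiv J (P.prod Q) := by
  set J' := J.map Prod.swap with hJ'
  have : IsProbabilityMeasure J' := Measure.isProbabilityMeasure_map measurable_swap.aemeasurable
  have hfst : J'.fst = J.snd := by simp [hJ', Measure.fst_map_swap]
  have hJ : J = J'.map Prod.swap := by
    rw [hJ', Measure.map_map measurable_swap measurable_swap]; simp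
  have hQ : (P.prod Q).map Prod.swap = Q ⊗ₘ Kernel.const β P := by
    rw [Measure.prod_swap, Measure.compProd_const]
  have hdis : J'.fst ⊗ₘ J'.condKernel = J' := J'.disintegrate J'.condKernel
  calc klDiv J (P.prod J.snd)
      = klDiv (J'.map Prod.swap) ((J'.fst ⊗ₘ Kernel.const β P).map Prod.swap) := by
        rw [← hJ, Measure.compProd_const, Measure.prod_swap, hfst]
    _ ≤ klDiv J' (J'.fst ⊗ₘ Kernel.const β P) := klDiv_map_le _ _ measurable_swap
    _ ≤ klDiv J'.fst Q + klDiv (J'.fst ⊗ₘ J'.condKernel) (J'.fst ⊗ₘ Kernel.const β P) := by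
        rw [hdis]; exact le_add_self
    _ = klDiv J' (Q ⊗ₘ Kernel.const β P) := by
        rw [← klDiv_compProd_eq_add, hdis]
    _ ≤ klDiv J (P.prod Q) := by
        rw [← hQ, hJ']; exact klDiv_map_le _ _ measurable_swap

/-- The Donsker–Varadhan lower bound `∫ f dμ - log ∫ exp f dν ≤ D(μ ‖ ν)`: the difference of the
two sides is the relative entropy of `μ` with respect to the tilted measure `ν.tilted f`. -/
lemma le_klDiv_of_integral_exp_le {μ ν : Measure α} [IsProbabilityMeasure μ]
    [IsProbabilityMeasure ν] {f : α → ℝ} {D m : ℝ} (hfμ : Integrable f μ)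
    (hfν : Integrable (fun x => Real.exp (f x)) ν) (hD : -D ≤ ∫ x, f x ∂μ)
    (hm : ∫ x, Real.exp (f x) ∂ν ≤ m) :
    ENNReal.ofReal (-D - Real.log m) ≤ klDiv μ ν := by
  by_cases hac : μ ≪ ν
  swap; · simp [hac]
  by_cases hint : Integrable (llr μ ν) μ
  swap; · simp [hint]
  have := isProbabilityMeasure_tilted hfν
  have hac' : μ ≪ ν.tilted f := hac.trans (absolutelyContinuous_tilted hfν)
  have h := integral_llr_add_sub_measure_univ_nonneg hac'
    (integrable_llr_tilted_right hac hfμ hint hfν)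
  rw [integral_llr_tilted_right hac hfμ hfν hint] at h
  rw [klDiv_of_ac_of_integrable hac hint]
  refine ENNReal.ofReal_le_ofReal ?_
  simp only [probReal_univ, add_sub_cancel_right] at h ⊢
  have := Real.log_le_log (integral_exp_pos hfν) hm
  linarith

end Information

/-! ### Translates of Gaussian measures -/

lemma gaussianReal_le_smul {b v : ℝ} (hv : |v| ≤ b) :
    gaussianReal v 1 ≤ ENNReal.ofReal (√2 * Real.exp (b ^ 2 / 2)) • gaussianReal 0 2 := by
  rw [gaussianReal_of_var_ne_zero _ one_ne_zero, gaussianReal_of_var_ne_zero _ two_ne_zero,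
    ← withDensity_smul _ (measurable_gaussianPDF _ _)]
  refine withDensity_mono (ae_of_all _ fun x => ?_)
  rw [Pi.smul_apply, gaussianPDF, gaussianPDF, smul_eq_mul, ← ENNReal.ofReal_mul (by positivity)]
  refine ENNReal.ofReal_le_ofReal ?_
  simp only [gaussianPDFReal_def, NNReal.coe_one, NNReal.coe_ofNat, mul_one, sub_zero]
  have h2 : √(2 * Real.pi * 2) = √(2 * Real.pi) * √2 := Real.sqrt_mul (by positivity) _
  have hexp : Real.exp (-(x - v) ^ 2 / 2) ≤ Real.exp (b ^ 2 / 2) * Real.exp (-x ^ 2 / (2 * 2)) := by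
    rw [← Real.exp_add]
    refine Real.exp_le_exp.mpr ?_
    have := sq_le_sq' (abs_le.mp hv).1 (abs_le.mp hv).2
    nlinarith [sq_nonneg (x - 2 * v)]
  have h0 : 0 < √(2 * Real.pi) := by positivity
  have h2' : 0 < √(2 : ℝ) := by positivity
  calc _ ≤ (√(2 * Real.pi))⁻¹ * (Real.exp (b ^ 2 / 2) * Real.exp (-x ^ 2 / (2 * 2))) := by gcongr
    _ = _ := by rw [h2]; field_simp

lemma pi_le_pow_smul_pi {ι : Type*} [Fintype ι] {α : ι → Type*} [∀ i, MeasurableSpace (α i)]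
    {μ ν : ∀ i, Measure (α i)} [∀ i, SigmaFinite (μ i)] [∀ i, SigmaFinite (ν i)] {C : ℝ≥0∞}
    (hC : C ≠ ∞) (h : ∀ i, μ i ≤ C • ν i) :
    Measure.pi μ ≤ C ^ Fintype.card ι • Measure.pi ν := by
  lift C to NNReal using hC
  have hpi : Measure.pi (fun i => C • ν i) = C ^ Fintype.card ι • Measure.pi ν := by
    refine Measure.pi_eq fun s _ => ?_
    simp only [Measure.smul_apply, ENNReal.smul_def, smul_eq_mul, Measure.pi_pi,
      Finset.prod_mul_distrib, Finset.prod_const, Finset.card_univ, ENNReal.coe_pow]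
  have hle : (Measure.pi μ).toOuterMeasure ≤
      OuterMeasure.pi fun i => (C • ν i).toOuterMeasure := by
    refine OuterMeasure.le_pi.mpr fun s _ => ?_
    change Measure.pi μ (Set.univ.pi s) ≤ ∏ i, (C • ν i) (s i)
    rw [Measure.pi_pi]
    exact Finset.prod_le_prod' fun i _ => h i (s i)
  refine Measure.le_intro fun s hs _ => ?_
  calc Measure.pi μ s ≤ OuterMeasure.pi (fun i => (C • ν i).toOuterMeasure) s := hle s
    _ = Measure.pi (fun i => C • ν i) s := by
      rw [Measure.pi, toMeasure_apply _ _ hs]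
    _ = _ := by rw [hpi]; simp [ENNReal.smul_def]

/-- The translates of a standard Gaussian vector by vectors of bounded norm are dominated, up to a
constant factor, by a single probability measure: the Gaussian vector of doubled variance. -/
lemma exists_forall_map_add_stdGaussian_le (n : ℕ) (b : ℝ) :
    ∃ (C : ℝ≥0∞) (G : Measure (EuclideanSpace ℝ (Fin n))), C ≠ 0 ∧ C ≠ ∞ ∧
      IsProbabilityMeasure G ∧ ∀ v : EuclideanSpace ℝ (Fin n), ‖v‖ ≤ b →
        (stdGaussian (EuclideanSpace ℝ (Fin n))).map (fun z => v + z) ≤ C • G := by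
  refine ⟨ENNReal.ofReal (√2 * Real.exp (b ^ 2 / 2)) ^ Fintype.card (Fin n),
    (Measure.pi fun _ => gaussianReal 0 2).map (WithLp.toLp 2), ?_, by finiteness,
    Measure.isProbabilityMeasure_map (by fun_prop), fun v hv => ?_⟩
  · refine pow_ne_zero _ (ENNReal.ofReal_pos.mpr (by positivity)).ne'
  · have hpi : (stdGaussian (EuclideanSpace ℝ (Fin n))).map (fun z => v + z) =
        (Measure.pi fun i => gaussianReal (v i) 1).map (WithLp.toLp 2) := by
      have hshift : (Measure.pi fun i => gaussianReal (v i) 1) =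
          (Measure.pi fun _ : Fin n => gaussianReal 0 1).map (fun x i => v i + x i) := by
        rw [Measure.pi_map_pi (f := fun i x => v i + x) (fun i => by fun_prop)]
        simp [gaussianReal_map_const_add]
      rw [hshift, ← map_pi_eq_stdGaussian, Measure.map_map (by fun_prop) (by fun_prop),
        Measure.map_map (by fun_prop) (by fun_prop)]
      rfl
    rw [hpi, ← Measure.map_smul]
    refine Measure.map_mono (pi_le_pow_smul_pi ENNReal.ofReal_ne_top fun i => ?_) (by fun_prop)
    exact gaussianReal_le_smul ((PiLp.norm_apply_le v i).trans hv)

/-! ### The joint law -/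

section JointLaw

open InformationTheory

variable {nr nt : ℕ} (H : Matrix (Fin nr) (Fin nt) ℝ) (P : Measure (EuclideanSpace ℝ (Fin nt)))

lemma measurable_channel :
    Measurable fun p : EuclideanSpace ℝ (Fin nt) × EuclideanSpace ℝ (Fin nr) =>
      (p.1, Matrix.toEuclideanLin H p.1 + p.2) := by
  have : Measurable (Matrix.toEuclideanLin H) :=
    (LinearMap.continuous_of_finiteDimensional _).measurable
  fun_prop

instance isProbabilityMeasure_jointLaw [IsProbabilityMeasure P] :
    IsProbabilityMeasure (jointLaw H P) :=
  Measure.isProbabilityMeasure_map (measurable_channel H).aemeasurable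

lemma fst_jointLaw [IsProbabilityMeasure P] : (jointLaw H P).fst = P := by
  rw [Measure.fst, jointLaw, Measure.map_map measurable_fst (measurable_channel H)]
  exact Measure.fst_prod

variable {H P}

/-- If all conditional laws of the channel output are dominated by `M • Q`, then the mutual
information, in nats, is at most `log M`. -/
lemma klDiv_jointLaw_le [IsProbabilityMeasure P] {Q : Measure (EuclideanSpace ℝ (Fin nr))}
    [IsProbabilityMeasure Q] {M : ℝ≥0∞} (hM : M ≠ ∞)
    (h : ∀ᵐ x ∂P, (stdGaussian (EuclideanSpace ℝ (Fin nr))).map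
      (fun z => Matrix.toEuclideanLin H x + z) ≤ M • Q) :
    klDiv (jointLaw H P) ((jointLaw H P).fst.prod (jointLaw H P).snd) ≤
      ENNReal.ofReal (Real.log M.toReal) := by
  rw [fst_jointLaw]
  refine (klDiv_prod_snd_le _ P Q).trans (klDiv_le_log_of_le_smul hM ?_)
  refine Measure.le_intro fun s hs _ => ?_
  rw [jointLaw, Measure.map_apply (measurable_channel H) hs,
    Measure.prod_apply (measurable_channel H hs), Measure.smul_apply, smul_eq_mul,
    Measure.prod_apply hs, ← lintegral_const_mul _ (measurable_measure_prodMk_left hs)]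
  refine lintegral_mono_ae ?_
  filter_upwards [h] with x hx
  have := hx (Prod.mk x ⁻¹' s)
  rwa [Measure.map_apply (by fun_prop) (measurable_prodMk_left hs)] at this

end JointLaw

/-! ### Uniform inputs on cubes -/

/-- The uniform distribution on the cube `[-a, a]ᵏ`, which is the closed ball of radius `a` for the
sup norm. -/
noncomputable def cubeUniform (k : ℕ) (a : ℝ) : Measure (Fin k → ℝ) :=
  volume[|Metric.closedBall (0 : Fin k → ℝ) a]

lemma isProbabilityMeasure_cubeUniform (k : ℕ) {a : ℝ} (ha : 0 < a) :
    IsProbabilityMeasure (cubeUniform k a) := by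
  refine cond_isProbabilityMeasure_of_finite ?_ ?_
  · rw [Real.volume_pi_closedBall _ ha.le]
    exact (ENNReal.ofReal_pos.mpr (by positivity)).ne'
  · rw [Real.volume_pi_closedBall _ ha.le]
    exact ENNReal.ofReal_ne_top

lemma ae_norm_le_cubeUniform (k : ℕ) (a : ℝ) : ∀ᵐ u ∂cubeUniform k a, ‖u‖ ≤ a := by
  filter_upwards [ae_cond_mem (μ := volume) (s := Metric.closedBall (0 : Fin k → ℝ) a)
    Metric.isClosed_closedBall.measurableSet] with u hu
  simpa using hu

lemma cubeUniform_closedBall_one {k : ℕ} {a : ℝ} {u : Fin k → ℝ} (hu : ‖u‖ + 1 ≤ a) :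
    cubeUniform k a (Metric.closedBall u 1) * ENNReal.ofReal (a ^ k) = 1 := by
  have ha : 0 < a := by linarith [norm_nonneg u]
  have hsub : Metric.closedBall u 1 ⊆ Metric.closedBall 0 a :=
    Metric.closedBall_subset_closedBall' (by simpa [add_comm] using hu)
  rw [cubeUniform, cond_apply Metric.isClosed_closedBall.measurableSet,
    Set.inter_eq_right.mpr hsub, Real.volume_pi_closedBall _ ha.le,
    Real.volume_pi_closedBall _ zero_le_one, mul_assoc, ← ENNReal.ofReal_mul (by positivity),
    Fintype.card_fin, ← mul_pow, mul_one]
  exact ENNReal.inv_mul_cancel (ENNReal.ofReal_pos.mpr (by positivity)).ne' ENNReal.ofReal_ne_top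

lemma integral_cubeUniform_le {k : ℕ} {a : ℝ} (ha : 0 < a) {g : (Fin k → ℝ) → ℝ}
    (hg : Integrable g) (hg0 : ∀ u, 0 ≤ g u) :
    ∫ u, g u ∂cubeUniform k a ≤ (∫ u, g u) / (2 * a) ^ k := by
  rw [cubeUniform, ProbabilityTheory.cond, integral_smul_measure,
    Real.volume_pi_closedBall _ ha.le, ENNReal.toReal_inv,
    ENNReal.toReal_ofReal (by positivity), Fintype.card_fin, smul_eq_mul, div_eq_inv_mul]
  exact mul_le_mul_of_nonneg_left (setIntegral_le_integral hg (ae_of_all _ hg0)) (by positivity)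

/-! ### Capacity bounds through a factorization of the channel matrix -/

section Bounds

open InformationTheory

variable {nr nt k : ℕ} {H : Matrix (Fin nr) (Fin nt) ℝ}

/-- If `H` factors through `ℝᵏ` as `A ∘ B`, and `B` maps the input space into the cube of side
`2 (a - 1)`, then the capacity is at most `k log a + O(1)`: the law of `A U + W`, where `U` is
uniform on the cube of side `2 a` and `W` is a slightly wider Gaussian noise, dominates all
conditional output laws up to a factor `O(aᵏ)`. -/
lemma exists_capacity_le (A : (Fin k → ℝ) →L[ℝ] EuclideanSpace ℝ (Fin nr))
    (B : EuclideanSpace ℝ (Fin nt) →L[ℝ] (Fin k → ℝ))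
    (hAB : ∀ x, Matrix.toEuclideanLin H x = A (B x)) :
    ∃ c : ℝ, ∀ (a : ℝ) (S : Set (EuclideanSpace ℝ (Fin nt))), 0 < a → (∀ x ∈ S, ‖B x‖ + 1 ≤ a) →
      capacity S H ≤ ENNReal.ofReal (k * Real.log a + c) / ENNReal.ofReal (Real.log 2) := by
  obtain ⟨C, G, hC0, hC, hG, hCG⟩ := exists_forall_map_add_stdGaussian_le nr ‖A‖
  refine ⟨Real.log C.toReal, fun a S ha hS => ?_⟩
  have hU := isProbabilityMeasure_cubeUniform k ha
  have hmeas : Measurable fun p : (Fin k → ℝ) × EuclideanSpace ℝ (Fin nr) => A p.1 + p.2 := by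
    fun_prop
  set Q := ((cubeUniform k a).prod G).map (fun p => A p.1 + p.2) with hQ
  have hQprob : IsProbabilityMeasure Q := Measure.isProbabilityMeasure_map hmeas.aemeasurable
  set γ := stdGaussian (EuclideanSpace ℝ (Fin nr))
  have hdom : ∀ x ∈ S, γ.map (fun z => Matrix.toEuclideanLin H x + z) ≤
      (C * ENNReal.ofReal (a ^ k)) • Q := by
    intro x hx
    refine Measure.le_intro fun s hs _ => ?_
    set m := γ.map (fun z => Matrix.toEuclideanLin H x + z) s with hm
    have hshift : ∀ u ∈ Metric.closedBall (B x) 1, m ≤ C * G {z | A u + z ∈ s} := by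
      intro u hu
      have hAu : ‖A (B x) - A u‖ ≤ ‖A‖ := by
        rw [← map_sub]
        refine (A.le_opNorm _).trans (mul_le_of_le_one_right (norm_nonneg _) ?_)
        rwa [← dist_eq_norm, dist_comm]
      have h := hCG _ hAu {z | A u + z ∈ s}
      have hset : MeasurableSet {z | A u + z ∈ s} :=
        (by fun_prop : Measurable fun z => A u + z) hs
      rw [Measure.map_apply (by fun_prop) hset] at h
      rw [hm, Measure.map_apply (by fun_prop) hs]
      have hpre : (fun z => A (B x) - A u + z) ⁻¹' {z | A u + z ∈ s} =
          (fun z => Matrix.toEuclideanLin H x + z) ⁻¹' s := by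
        ext z
        simp [hAB, ← add_assoc]
      rwa [hpre, Measure.smul_apply, smul_eq_mul] at h
    have hQs : Q s = ∫⁻ u, G {z | A u + z ∈ s} ∂cubeUniform k a := by
      rw [hQ, Measure.map_apply hmeas hs, Measure.prod_apply (hmeas hs)]
      rfl
    have hle : m * cubeUniform k a (Metric.closedBall (B x) 1) ≤ C * Q s := by
      calc m * cubeUniform k a (Metric.closedBall (B x) 1)
          = ∫⁻ _ in Metric.closedBall (B x) 1, m ∂cubeUniform k a := by simp
        _ ≤ ∫⁻ u in Metric.closedBall (B x) 1, C * G {z | A u + z ∈ s} ∂cubeUniform k a :=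
          setLIntegral_mono' Metric.isClosed_closedBall.measurableSet hshift
        _ ≤ ∫⁻ u, C * G {z | A u + z ∈ s} ∂cubeUniform k a := setLIntegral_le_lintegral _ _
        _ = C * Q s := by
          rw [lintegral_const_mul' _ _ hC, hQs]
    calc m = m * cubeUniform k a (Metric.closedBall (B x) 1) * ENNReal.ofReal (a ^ k) := by
          rw [mul_assoc, cubeUniform_closedBall_one (hS x hx), mul_one]
      _ ≤ C * Q s * ENNReal.ofReal (a ^ k) := by gcongr
      _ = ((C * ENNReal.ofReal (a ^ k)) • Q) s := by
          rw [Measure.smul_apply, smul_eq_mul]; ring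
  have hlog : Real.log (C * ENNReal.ofReal (a ^ k)).toReal =
      k * Real.log a + Real.log C.toReal := by
    rw [ENNReal.toReal_mul, ENNReal.toReal_ofReal (by positivity),
      Real.log_mul (ENNReal.toReal_pos hC0 hC).ne' (by positivity), Real.log_pow, add_comm]
  refine iSup_le fun P => iSup_le fun _ => iSup_le fun hP => ?_
  rw [← hlog]
  refine ENNReal.div_le_div_right ?_ _
  exact klDiv_jointLaw_le (by finiteness) (hP.mono hdom)

/-- If `H` has a section of dimension `k` whose image of the cube of side `2 a` lies in the input
space, then the capacity is at least `k log a - O(1)`: the uniform input on that cube achieves this,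
by the Donsker–Varadhan bound for the test function `-(k + 1) log (1 + ‖L y - L H x‖)`. -/
lemma exists_le_capacity (L : EuclideanSpace ℝ (Fin nr) →L[ℝ] (Fin k → ℝ))
    (V : (Fin k → ℝ) →L[ℝ] EuclideanSpace ℝ (Fin nt))
    (hLV : ∀ u, L (Matrix.toEuclideanLin H (V u)) = u) :
    ∃ c : ℝ, ∀ (a : ℝ) (S : Set (EuclideanSpace ℝ (Fin nt))), 0 < a → (∀ u, ‖u‖ ≤ a → V u ∈ S) →
      ENNReal.ofReal (k * Real.log a + c) / ENNReal.ofReal (Real.log 2) ≤ capacity S H := by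
  set γ := stdGaussian (EuclideanSpace ℝ (Fin nr))
  set K := ∫ u : Fin k → ℝ, (1 + ‖u‖) ^ (-((k : ℝ) + 1))
  set D := ∫ z, ((k : ℝ) + 1) * ‖L z‖ ∂γ
  refine ⟨k * Real.log 2 - D - Real.log (K + 1), fun a S ha hS => ?_⟩
  have hK0 : 0 ≤ K := integral_nonneg fun u => by positivity
  have hK : Integrable fun u : Fin k → ℝ => (1 + ‖u‖) ^ (-((k : ℝ) + 1)) :=
    integrable_one_add_norm (by simp)
  have hU := isProbabilityMeasure_cubeUniform k ha
  set P := (cubeUniform k a).map V with hP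
  have hPprob : IsProbabilityMeasure P := Measure.isProbabilityMeasure_map (by fun_prop)
  have hPS : ∀ᵐ x ∂P, x ∈ V '' Metric.closedBall 0 a := by
    refine (ae_map_iff (by fun_prop) ?_).mpr ?_
    · exact ((isCompact_closedBall _ _).image V.continuous).measurableSet
    · filter_upwards [ae_norm_le_cubeUniform k a] with u hu
      exact ⟨u, by simpa using hu, rfl⟩
  have hPS' : ∀ᵐ x ∂P, x ∈ S := by
    filter_upwards [hPS] with x ⟨u, hu, hux⟩
    exact hux ▸ hS u (by simpa using hu)
  refine le_trans ?_ (le_iSup_of_le P (le_iSup_of_le hPprob (le_iSup_of_le hPS' le_rfl)))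
  refine ENNReal.div_le_div_right ?_ _
  rw [fst_jointLaw]
  set Q := (jointLaw H P).snd
  have hHm : Measurable (Matrix.toEuclideanLin H) :=
    (LinearMap.continuous_of_finiteDimensional _).measurable
  set f : EuclideanSpace ℝ (Fin nt) × EuclideanSpace ℝ (Fin nr) → ℝ := fun p =>
    -(((k : ℝ) + 1) * Real.log (1 + ‖L p.2 - L (Matrix.toEuclideanLin H p.1)‖)) with hf
  have hfm : Measurable f := by fun_prop
  have hexp : ∀ p, Real.exp (f p) =
      (1 + ‖L p.2 - L (Matrix.toEuclideanLin H p.1)‖) ^ (-((k : ℝ) + 1)) := fun p => by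
    rw [Real.rpow_def_of_pos (by positivity), hf]
    ring_nf
  have hLint : Integrable (fun z => ((k : ℝ) + 1) * ‖L z‖) γ :=
    ((L.integrable_comp IsGaussian.integrable_fun_id).norm).const_mul _
  have hlog : ∀ z : EuclideanSpace ℝ (Fin nr),
      0 ≤ ((k : ℝ) + 1) * Real.log (1 + ‖L z‖) ∧
        ((k : ℝ) + 1) * Real.log (1 + ‖L z‖) ≤ ((k : ℝ) + 1) * ‖L z‖ := fun z => by
    have h1 : Real.log (1 + ‖L z‖) ≤ ‖L z‖ := by
      linarith [Real.log_le_sub_one_of_pos (x := 1 + ‖L z‖) (by positivity)]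
    exact ⟨mul_nonneg (by positivity) (Real.log_nonneg (by simp)), by gcongr⟩
  have hlogint : Integrable (fun z => -(((k : ℝ) + 1) * Real.log (1 + ‖L z‖))) γ := by
    refine hLint.mono' (by fun_prop : Measurable _).aestronglyMeasurable (ae_of_all _ fun z => ?_)
    rw [norm_neg, Real.norm_of_nonneg (hlog z).1]
    exact (hlog z).2
  -- Along the channel the test function only depends on the noise.
  have hcomp : (f ∘ fun p : EuclideanSpace ℝ (Fin nt) × EuclideanSpace ℝ (Fin nr) =>
      (p.1, Matrix.toEuclideanLin H p.1 + p.2)) = fun p => -(((k : ℝ) + 1) * Real.log (1 + ‖L p.2‖)) := by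
    ext p
    simp [hf]
  have hfint : Integrable f (jointLaw H P) := by
    rw [jointLaw, integrable_map_measure hfm.aestronglyMeasurable
      (measurable_channel H).aemeasurable, hcomp]
    exact hlogint.comp_snd P
  have hfD : -D ≤ ∫ p, f p ∂jointLaw H P := by
    rw [jointLaw, integral_map (measurable_channel H).aemeasurable hfm.aestronglyMeasurable]
    have : ∀ p : EuclideanSpace ℝ (Fin nt) × EuclideanSpace ℝ (Fin nr),
        f (p.1, Matrix.toEuclideanLin H p.1 + p.2) =
          -(((k : ℝ) + 1) * Real.log (1 + ‖L p.2‖)) := fun p => congrFun hcomp p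
    simp only [this]
    rw [integral_fun_snd (fun z => -(((k : ℝ) + 1) * Real.log (1 + ‖L z‖)))]
    simp only [probReal_univ, one_smul]
    rw [← integral_neg]
    exact integral_mono hLint.neg hlogint fun z => neg_le_neg (hlog z).2
  have hexpint : Integrable (fun p => Real.exp (f p)) (P.prod Q) := by
    refine Integrable.of_bound (by fun_prop) 1 (ae_of_all _ fun p => ?_)
    rw [Real.norm_of_nonneg (Real.exp_nonneg _), Real.exp_le_one_iff]
    exact neg_nonpos.mpr (mul_nonneg (by positivity) (Real.log_nonneg (by simp)))
  have hm : ∫ p, Real.exp (f p) ∂P.prod Q ≤ (K + 1) / (2 * a) ^ k := by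
    rw [integral_prod_symm _ hexpint]
    have hinner : ∀ y, ∫ x, Real.exp (f (x, y)) ∂P ≤ (K + 1) / (2 * a) ^ k := fun y => by
      rw [hP, integral_map (by fun_prop)
        (by fun_prop : Measurable fun x => Real.exp (f (x, y))).aestronglyMeasurable]
      simp only [hexp, hLV]
      calc ∫ u, (1 + ‖L y - u‖) ^ (-((k : ℝ) + 1)) ∂cubeUniform k a
          ≤ (∫ u, (1 + ‖L y - u‖) ^ (-((k : ℝ) + 1))) / (2 * a) ^ k :=
            integral_cubeUniform_le ha (hK.comp_sub_left (L y)) fun u => by positivity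
        _ = K / (2 * a) ^ k := by
            rw [integral_sub_left_eq_self (fun u => (1 + ‖u‖) ^ (-((k : ℝ) + 1))) volume (L y)]
        _ ≤ _ := by gcongr; linarith
    calc ∫ y, ∫ x, Real.exp (f (x, y)) ∂P ∂Q ≤ ∫ _, (K + 1) / (2 * a) ^ k ∂Q :=
          integral_mono hexpint.integral_prod_right (integrable_const _) hinner
      _ = _ := by simp
  convert le_klDiv_of_integral_exp_le hfint hexpint hfD hm using 2
  rw [Real.log_div (by positivity) (by positivity), Real.log_pow,
    Real.log_mul two_ne_zero ha.ne']
  ring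

end Bounds

/-! ### Radii and the rank factorization -/

/-- Halving the radius avoids showing that the supremum defining `rMin` is attained. -/
lemma closedBall_half_rMin_subset {n : ℕ} {S : Set (EuclideanSpace ℝ (Fin n))}
    (h : 0 < rMin S) : Metric.closedBall 0 (rMin S / 2) ⊆ S := by
  have hne : {r : ℝ | 0 ≤ r ∧ Metric.closedBall 0 r ⊆ S}.Nonempty := by
    by_contra hempty
    rw [Set.not_nonempty_iff_eq_empty] at hempty
    simp [rMin, hempty] at h
  obtain ⟨r, hr, hlt⟩ := exists_lt_of_lt_csSup hne (half_lt_self h)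
  exact (Metric.closedBall_subset_closedBall hlt.le).trans hr.2

lemma norm_le_rMax_add_one {n : ℕ} {S : Set (EuclideanSpace ℝ (Fin n))} (hS : IsCompact S)
    {x : EuclideanSpace ℝ (Fin n)} (hx : x ∈ S) : ‖x‖ ≤ rMax S + 1 := by
  have hne : {r : ℝ | 0 ≤ r ∧ S ⊆ Metric.closedBall 0 r}.Nonempty := by
    obtain ⟨r, hr⟩ := hS.isBounded.subset_closedBall 0
    exact ⟨max r 0, le_max_right _ _,
      hr.trans (Metric.closedBall_subset_closedBall (le_max_left _ _))⟩
  obtain ⟨r, hr, hlt⟩ := exists_lt_of_csInf_lt hne (lt_add_one (rMax S))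
  have := hr.2 hx
  rw [mem_closedBall_zero_iff] at this
  linarith

/-- The rank factorization of a matrix, with a left inverse of the injective factor and a right
inverse of the surjective one. -/
lemma exists_rank_factorization {nr nt : ℕ} (H : Matrix (Fin nr) (Fin nt) ℝ) {k : ℕ}
    (hk : H.rank = k) :
    ∃ (A : (Fin k → ℝ) →L[ℝ] EuclideanSpace ℝ (Fin nr))
      (B : EuclideanSpace ℝ (Fin nt) →L[ℝ] (Fin k → ℝ))
      (L : EuclideanSpace ℝ (Fin nr) →L[ℝ] (Fin k → ℝ))
      (V : (Fin k → ℝ) →L[ℝ] EuclideanSpace ℝ (Fin nt)),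
      (∀ x, Matrix.toEuclideanLin H x = A (B x)) ∧ (∀ u, L (A u) = u) ∧ ∀ u, B (V u) = u := by
  set T := Matrix.toEuclideanLin H with hT
  have hrank : Module.finrank ℝ (LinearMap.range T) = Module.finrank ℝ (Fin k → ℝ) := by
    rw [Module.finrank_fin_fun, hT, Matrix.toEuclideanLin_eq_toLin_orthonormal, ← hk]
    exact (Matrix.rank_eq_finrank_range_toLin H _ _).symm
  let e : LinearMap.range T ≃ₗ[ℝ] (Fin k → ℝ) := LinearEquiv.ofFinrankEq _ _ hrank
  let A := (LinearMap.range T).subtype ∘ₗ e.symm.toLinearMap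
  let B := e.toLinearMap ∘ₗ T.rangeRestrict
  have hA : Function.Injective A := (Submodule.subtype_injective _).comp e.symm.injective
  have hB : Function.Surjective B := e.surjective.comp T.surjective_rangeRestrict
  obtain ⟨L, hL⟩ := A.exists_leftInverse_of_injective (LinearMap.ker_eq_bot.mpr hA)
  obtain ⟨V, hV⟩ := B.exists_rightInverse_of_surjective (LinearMap.range_eq_top.mpr hB)
  refine ⟨A.toContinuousLinearMap, B.toContinuousLinearMap, L.toContinuousLinearMap,
    V.toContinuousLinearMap, fun x => ?_, fun u => ?_, fun u => ?_⟩
  · simp [A, B]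
  · exact LinearMap.congr_fun hL u
  · exact LinearMap.congr_fun hV u

/-! ### The growth rate of the capacity -/

lemma tendsto_mul_log_add_div_log_one_add (k c : ℝ) {β : ℝ} (hβ : 0 < β) :
    Tendsto (fun r : ℝ => (k * Real.log r + c) / Real.log (1 + β * r)) atTop (𝓝 k) := by
  have hden : Tendsto (fun r : ℝ => Real.log (1 + β * r)) atTop atTop :=
    Real.tendsto_log_atTop.comp
      (tendsto_atTop_add_const_left _ _ (tendsto_id.const_mul_atTop hβ))
  have hcorr : Tendsto (fun r : ℝ => c - k * Real.log (r⁻¹ + β)) atTop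
      (𝓝 (c - k * Real.log (0 + β))) :=
    ((tendsto_inv_atTop_zero.add_const β).log (by simpa using hβ.ne')).const_mul k
      |>.const_sub c
  have hlim := (hcorr.div_atTop hden).const_add k
  rw [add_zero] at hlim
  refine hlim.congr' ?_
  filter_upwards [eventually_gt_atTop 0, hden.eventually_gt_atTop 0] with r hr hpos
  -- `log (1 + β r) = log r + log (1 / r + β)`
  have h : Real.log (1 + β * r) = Real.log r + Real.log (r⁻¹ + β) := by
    rw [← Real.log_mul hr.ne' (by positivity)]
    congr 1
    field_simp
  rw [eq_div_iff hpos.ne', add_mul, div_mul_cancel₀ _ hpos.ne', h]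
  ring

lemma ofReal_div_log_two_div_logb (t : ℝ) {w : ℝ} (hw : 1 < w) :
    ENNReal.ofReal t / ENNReal.ofReal (Real.log 2) / ENNReal.ofReal (Real.logb 2 w) =
      ENNReal.ofReal (t / Real.log w) := by
  have h2 : 0 < Real.log 2 := Real.log_pos one_lt_two
  have hlw : 0 < Real.log w := Real.log_pos hw
  rw [← ENNReal.ofReal_div_of_pos h2, ← ENNReal.ofReal_div_of_pos (by
    exact Real.logb_pos one_lt_two hw), Real.logb]
  congr 1
  field_simp

end MIMO

theorem mainTheorem1 (nr nt : ℕ) (hnr : 0 < nr) (hnt : 0 < nt)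
    (H : Matrix (Fin nr) (Fin nt) ℝ) (hH : H.rank = min nr nt) (c : ℝ) :
    Tendsto
      (fun S : Set (EuclideanSpace ℝ (Fin nt)) =>
        MIMO.capacity S H /
          ENNReal.ofReal
            (Real.logb 2 (1 + 2 * MIMO.rMin S / Real.sqrt (2 * Real.pi * Real.exp 1))))
      (comap MIMO.rMin atTop ⊓ 𝓟 (MIMO.inputSpaces nt c))
      (𝓝 ((min nr nt : ℕ) : ℝ≥0∞)) := by
  set k := min nr nt
  obtain ⟨A, B, L, V, hAB, hLA, hBV⟩ := MIMO.exists_rank_factorization H hH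
  obtain ⟨c₁, h₁⟩ := MIMO.exists_capacity_le A B hAB
  obtain ⟨c₂, h₂⟩ := MIMO.exists_le_capacity L V fun u => by rw [hAB, hBV, hLA]
  set s := √(2 * Real.pi * Real.exp 1)
  have hs : 0 < s := by positivity
  have hβ : 0 < 2 / s := by positivity
  -- The half-widths of the cubes containing the image of `S` under `B`, and sent into `S` by `V`,
  -- are `α₁ * rMin S` and `α₂ * rMin S`.
  set α₁ := ‖B‖ * (|c| + 1) + 1
  set α₂ := (2 * (‖V‖ + 1))⁻¹
  have hα₁ : 0 < α₁ := by positivity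
  have hα₂ : 0 < α₂ := by positivity
  have hr : Tendsto (MIMO.rMin (n := nt))
      (comap MIMO.rMin atTop ⊓ 𝓟 (MIMO.inputSpaces nt c)) atTop :=
    tendsto_comap.mono_left inf_le_left
  have hlim : ∀ C : ℝ, Tendsto (fun S : Set (EuclideanSpace ℝ (Fin nt)) =>
      ENNReal.ofReal ((k * Real.log (MIMO.rMin S) + C) / Real.log (1 + 2 / s * MIMO.rMin S)))
      (comap MIMO.rMin atTop ⊓ 𝓟 (MIMO.inputSpaces nt c)) (𝓝 (k : ℝ≥0∞)) := fun C => by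
    rw [← ENNReal.ofReal_natCast k]
    exact (ENNReal.continuous_ofReal.tendsto _).comp
      ((MIMO.tendsto_mul_log_add_div_log_one_add k C hβ).comp hr)
  have hmem : ∀ᶠ S in comap MIMO.rMin atTop ⊓ 𝓟 (MIMO.inputSpaces nt c),
      S ∈ MIMO.inputSpaces nt c := mem_inf_of_right (mem_principal_self _)
  have hlarge := hr.eventually_ge_atTop 1
  refine tendsto_of_tendsto_of_tendsto_of_le_of_le' (hlim (k * Real.log α₂ + c₂))
    (hlim (k * Real.log α₁ + c₁)) ?_ ?_
  · filter_upwards [hlarge] with S hS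
    have hS0 : 0 < MIMO.rMin S := by linarith
    have hw : 1 < 1 + 2 / s * MIMO.rMin S := by linarith [mul_pos hβ hS0]
    have hle := h₂ (α₂ * MIMO.rMin S) S (by positivity) fun u hu => by
      refine MIMO.closedBall_half_rMin_subset hS0 (mem_closedBall_zero_iff.mpr ?_)
      calc ‖V u‖ ≤ ‖V‖ * ‖u‖ := V.le_opNorm u
        _ ≤ (‖V‖ + 1) * (α₂ * MIMO.rMin S) := by gcongr; linarith
        _ = MIMO.rMin S / 2 := by simp only [α₂]; field_simp
    rw [mul_div_right_comm 2 (MIMO.rMin S) s, ← MIMO.ofReal_div_log_two_div_logb _ hw]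
    refine ENNReal.div_le_div_right ?_ _
    rwa [Real.log_mul hα₂.ne' hS0.ne', mul_add, add_comm (_ * Real.log α₂), add_assoc] at hle
  · filter_upwards [hlarge, hmem] with S hS hSmem
    obtain ⟨-, hcompact, -, hmax⟩ := hSmem
    have hS0 : 0 < MIMO.rMin S := by linarith
    have hw : 1 < 1 + 2 / s * MIMO.rMin S := by linarith [mul_pos hβ hS0]
    have hle := h₁ (α₁ * MIMO.rMin S) S (by positivity) fun x hx => by
      have hx' : ‖x‖ ≤ (|c| + 1) * MIMO.rMin S := by
        nlinarith [MIMO.norm_le_rMax_add_one hcompact hx, le_abs_self c]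
      calc ‖B x‖ + 1 ≤ ‖B‖ * ‖x‖ + 1 := by gcongr; exact B.le_opNorm x
        _ ≤ ‖B‖ * ((|c| + 1) * MIMO.rMin S) + MIMO.rMin S := by gcongr
        _ = α₁ * MIMO.rMin S := by simp only [α₁]; ring
    rw [mul_div_right_comm 2 (MIMO.rMin S) s, ← MIMO.ofReal_div_log_two_div_logb _ hw]
    refine ENNReal.div_le_div_right ?_ _
    rwa [Real.log_mul hα₁.ne' hS0.ne', mul_add, add_comm (_ * Real.log α₁), add_assoc] at hle
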